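/- Let $n\ge 2$, let $G(n,k)$ and $A(n,k)$ denote the spaces of $k$-dimensional linear and affine subspaces of $\mathbb R^n$ with their natural topologies, and let $L(E)$ denote the linear subspace parallel to a flat $E$. A $k$-flat process $X$ is a simple point process on $A(n,k)$ (a random locally finite set of $k$-flats) whose intensity measure $\Theta=\mathbb E X$ is locally finite, i.e. $\Theta(\{E: E\cap C\ne\emptyset\})<\infty$ for compact $C$; it is weakly stationary if $\Theta$ is translation invariant. A number $\gamma\in[0,\infty)$ and a probability measure $\mathbb Q$ on $G(n,k)$ are called intensity and directional distribution of a measure $\Theta$ on $A(n,k)$ (or of a process with intensity measure $\Theta$) if, for all Borel sets $A\subset A(n,k)$, $$\Theta(A)=\gamma\int_{G(n,k)}\int_{L^\perp}\mathbf 1\{L+x\in A\}\,dx\,\mathbb Q(dL)$$ (if $\gamma=0$, then $\mathbb Q$ is arbitrary). For $r\ge 2$, let $X^r_{\neq}$ be the set of $r$-tuples of distinct flats of $X$; $X$ is of type $(S_r)$ if its $r$-th factorial moment measure $\Theta^{(r)}(B)=\mathbb E\sum_{(E_1,\dots,E_r)\in X^r_{\ne}}\mathbf 1\{(E_1,\dots,E_r)\in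 B\}$ equals the $r$-fold product measure $\Theta^r$. For linear subspaces whose dimensions add up to at least $(r-1)n$, let $[L_1,\dots,L_r]$ be the volume of the parallelepiped spanned by the union of orthonormal bases of $L_1^\perp,\dots,L_r^\perp$, and put $[E_1,\dots,E_r]:=[L(E_1),\dots,L(E_r)]$ for flats. **Theorem.** Let $r\ge2$ and let $k$ be an integer with $n/2\le k\le n-1$ and $rk\ge (r-1)n$; put $q:=rk-(r-1)n$. Let $X$ be a weakly stationary $k$-flat process of type $(S_r)$ with intensity $\gamma$ and directional distribution $\mathbb Q$. Let $$X_{(r)}(\cdot)=\frac1{r!}\sum_{(E_1,\dots,E_r)\in X^r_{\neq}}\mathbf 1\{E_1\cap\dots\cap E_r\in\cdot\,\}\,\mathbf 1\{[E_1,\dots,E_r]>0\}$$ be its $r$-th intersection process, a process of $q$-flats. Then the intensity measure $\mathbb E X_{(r)}$ is translation invariant and locally finite, it has an intensity and a directional distribution, and for every choice of intensity $\gamma_{(r)}$ and directional distribution $\mathbb Q_{(r)}$ of $X_{(r)}$ and all Borel sets $A\subset G(n,q)$, $$\gamma_{(r)}\,\mathbb Q_{(r)}(A)=\frac{\gamma^r}{r!}\int_{G(n,k)}\cdots\int_{G(n,k)}\mathbf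 1\{L_1\cap\dots\cap L_r\in A\}\,[L_1,\dots,L_r]\,\mathbb Q(dL_r)\cdots\mathbb Q(dL_1).$$ -/

import Mathlib

open MeasureTheory
open scoped ENNReal NNReal Nat Pointwise

noncomputable section

namespace FlatProcesses

/-- Euclidean space `ℝⁿ`. -/
abbrev Space (n : ℕ) : Type := EuclideanSpace ℝ (Fin n)

/-- `G(n,k)`: the `k`-dimensional linear subspaces of `ℝⁿ`. -/
def Grassmannian (n k : ℕ) : Type :=
  {L : Submodule ℝ (Space n) // Module.finrank ℝ L = k}

/-- `A(n,k)`: the `k`-dimensional affine subspaces (`k`-flats) of `ℝⁿ`. -/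
def Flat (n k : ℕ) : Type :=
  {F : AffineSubspace ℝ (Space n) //
    (F : Set (Space n)).Nonempty ∧ Module.finrank ℝ F.direction = k}

namespace Grassmannian

variable {n k : ℕ}

/-- The natural topology of `G(n,k)`: subspaces are close if their orthogonal projections are
close in operator norm. -/
instance : TopologicalSpace (Grassmannian n k) :=
  TopologicalSpace.induced (fun L => L.1.starProjection) inferInstance

instance : MeasurableSpace (Grassmannian n k) := borel _

instance : BorelSpace (Grassmannian n k) := ⟨rfl⟩

end Grassmannian

namespace Flat

variable {n k : ℕ}

/-- The linear subspace `L(F)` parallel to the flat `F`. -/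
def dir (F : Flat n k) : Grassmannian n k := ⟨F.1.direction, F.2.2⟩

/-- The point of the flat `F` that is nearest to the origin. -/
def foot (F : Flat n k) : Space n :=
  haveI : Nonempty F.1 := F.2.1.to_subtype
  (EuclideanGeometry.orthogonalProjection F.1 (0 : Space n) : Space n)

/-- The natural topology of `A(n,k)`: a flat is `F = L(F) + foot F`, and two flats are close if
their directions and their points nearest to the origin are close. -/
instance : TopologicalSpace (Flat n k) :=
  TopologicalSpace.induced (fun F => (F.dir, F.foot)) inferInstance

instance : MeasurableSpace (Flat n k) := borel _

instance : BorelSpace (Flat n k) := ⟨rfl⟩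

/-- The flat `L + x`. -/
def ofDir (L : Grassmannian n k) (x : Space n) : Flat n k :=
  ⟨AffineSubspace.mk' x L.1, ⟨x, AffineSubspace.self_mem_mk' x L.1⟩, by
    rw [AffineSubspace.direction_mk']; exact L.2⟩

/-- The translate `F + z`. -/
def translate (z : Space n) (F : Flat n k) : Flat n k :=
  ⟨z +ᵥ F.1, by
    rw [AffineSubspace.coe_pointwise_vadd]; exact F.2.1.vadd_set, by
    rw [AffineSubspace.pointwise_vadd_direction]; exact F.2.2⟩

/-- The set of all `k`-flats that meet `C`. -/
def hitting (C : Set (Space n)) : Set (Flat n k) :=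
  {F | ((F.1 : Set (Space n)) ∩ C).Nonempty}

end Flat

/-- The `m`-dimensional volume of the parallelepiped spanned by the `m` vectors `v i`
(the square root of their Gram determinant). -/
def parallelepipedVolume {n : ℕ} {ι : Type} [Fintype ι] [DecidableEq ι] (v : ι → Space n) : ℝ :=
  Real.sqrt (Matrix.gram ℝ v).det

/-- The volume of the parallelepiped spanned by the union of orthonormal bases of
`L 0, …, L (r - 1)`. -/
def spanVolume {n r : ℕ} (L : Fin r → Submodule ℝ (Space n)) : ℝ :=
  parallelepipedVolume
    (fun p : (i : Fin r) × Fin (Module.finrank ℝ (L i)) =>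
      ((stdOrthonormalBasis ℝ (L p.1) p.2 : L p.1) : Space n))

/-- The subspace determinant `[L₁,…,L_r]`. If the dimensions add up to at least `(r - 1) n`, it is
computed from the orthogonal complements, otherwise from the subspaces themselves. -/
def subspaceDet {n r : ℕ} (L : Fin r → Submodule ℝ (Space n)) : ℝ :=
  if (r - 1) * n ≤ ∑ i, Module.finrank ℝ (L i) then spanVolume (fun i => (L i)ᗮ)
  else spanVolume L

section SetFunctions

variable {n k : ℕ}

/-- Translation invariance of (the set function given by) a measure on the Borel sets of
`A(n,k)`. -/
def IsTranslationInvariant (Θ : Set (Flat n k) → ℝ≥0∞) : Prop :=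
  ∀ (z : Space n) (A : Set (Flat n k)), MeasurableSet A → Θ (Flat.translate z ⁻¹' A) = Θ A

/-- Local finiteness: only finite mass on the flats that meet a given compact set. -/
def IsLocallyFiniteOnFlats (Θ : Set (Flat n k) → ℝ≥0∞) : Prop :=
  ∀ C : Set (Space n), IsCompact C → Θ (Flat.hitting C) < ∞

/-- `γ` is the intensity and `Q` is a directional distribution of `Θ`:
`Θ(A) = γ ∫_{G(n,k)} ∫_{L^⊥} 1{L + x ∈ A} dx Q(dL)` for all Borel sets `A`, where `dx` is
Lebesgue measure on `L^⊥`. -/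
def HasIntensityAndDirection (Θ : Set (Flat n k) → ℝ≥0∞) (γ : ℝ≥0)
    (Q : Measure (Grassmannian n k)) : Prop :=
  IsProbabilityMeasure Q ∧
    ∀ A : Set (Flat n k), MeasurableSet A →
      Θ A = γ * ∫⁻ L, volume {x : (L.1)ᗮ | Flat.ofDir L (x : Space n) ∈ A} ∂Q

end SetFunctions

/-- The simple counting measure given by a set `S` of points. -/
def countingMeasure {α : Type*} [MeasurableSpace α] (S : Set α) : Measure α :=
  Measure.sum fun e : S => Measure.dirac (e : α)

theorem countingMeasure_apply {α : Type*} [MeasurableSpace α] (S : Set α) {A : Set α}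
    (hA : MeasurableSet A) : countingMeasure S A = ((S ∩ A).encard : ℝ≥0∞) := by
  classical
  rw [countingMeasure, Measure.sum_apply _ hA]
  simp only [Measure.dirac_apply' _ hA]
  have h1 : ∀ e : S, A.indicator (1 : α → ℝ≥0∞) (e : α)
      = (Subtype.val ⁻¹' A : Set S).indicator (fun _ => (1 : ℝ≥0∞)) e := fun e => rfl
  simp only [h1]
  rw [← tsum_subtype, ENNReal.tsum_const, mul_one]
  rw [← ENat.card_coe_set_eq]
  norm_cast
  rw [ENat.card_coe_set_eq, ENat.card_coe_set_eq, ← Subtype.coe_injective.encard_image,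
    Subtype.image_preimage_coe]

section Processes

variable {Ω : Type*} [MeasurableSpace Ω] {n k : ℕ}

/-- The intensity measure `Θ = 𝔼 X`. -/
def intensityMeasure (P : Measure Ω) (X : Ω → Set (Flat n k)) : Measure (Flat n k) :=
  P.bind fun ω => countingMeasure (X ω)

/-- `X` is a `k`-flat process, that is, a simple point process on `A(n,k)` with locally finite
intensity measure. Realizations are identified with locally finite sets of flats, and
measurability refers to the `σ`-algebra generated by the counts of flats in Borel sets. -/
structure IsFlatProcess (P : Measure Ω) (X : Ω → Set (Flat n k)) : Prop where
  locallyFinite : ∀ ω, ∀ C : Set (Space n), IsCompact C → (X ω ∩ Flat.hitting C).Finite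
  measurable : Measurable fun ω => countingMeasure (X ω)
  intensity_locallyFinite : IsLocallyFiniteOnFlats (intensityMeasure P X)

theorem intensityMeasure_apply {P : Measure Ω} {X : Ω → Set (Flat n k)} (hX : IsFlatProcess P X)
    {A : Set (Flat n k)} (hA : MeasurableSet A) :
    intensityMeasure P X A = ∫⁻ ω, ((X ω ∩ A).encard : ℝ≥0∞) ∂P := by
  rw [intensityMeasure, Measure.bind_apply hA hX.measurable.aemeasurable]
  simp only [countingMeasure_apply _ hA]

/-- `X^m_≠`: the `m`-tuples of pairwise distinct elements of a set `S`. -/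
def distinctTuples {α : Type*} (m : ℕ) (S : Set α) : Set (Fin m → α) :=
  {e | Function.Injective e ∧ ∀ i, e i ∈ S}

/-- The `m`-th factorial moment measure `Θ^(m)` of `X`, evaluated at a Borel set `B`:
the expected number of `m`-tuples of distinct flats of `X` that belong to `B`. -/
def factorialMoment (P : Measure Ω) (X : Ω → Set (Flat n k)) (m : ℕ)
    (B : Set (Fin m → Flat n k)) : ℝ≥0∞ :=
  ∫⁻ ω, ((distinctTuples m (X ω) ∩ B).encard : ℝ≥0∞) ∂P

/-- `X` is weakly stationary: its intensity measure is translation invariant. -/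
def IsWeaklyStationary (P : Measure Ω) (X : Ω → Set (Flat n k)) : Prop :=
  IsTranslationInvariant (intensityMeasure P X)

/-- `X` is of type `(S_r)`: its `r`-th factorial moment measure is the `r`-fold product of its
intensity measure. -/
def IsOfTypeS (P : Measure Ω) (X : Ω → Set (Flat n k)) (r : ℕ) : Prop :=
  ∀ B : Set (Fin r → Flat n k), MeasurableSet B →
    factorialMoment P X r B = Measure.pi (fun _ : Fin r => intensityMeasure P X) B

/-- The flats `E₁,…,E_r` are in general position and `E₁ ∩ … ∩ E_r` belongs to the set `A` of
`q`-flats. -/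
def intersectsIn {r q : ℕ} (A : Set (Flat n q)) : Set (Fin r → Flat n k) :=
  {E | 0 < subspaceDet (fun i => (E i).dir.1) ∧ ∃ F ∈ A, F.1 = ⨅ i, (E i).1}

/-- The `r`-th intersection process `X_(r)`, evaluated at `A ⊆ A(n,q)`, for the realization `S`
of `X`: the sum of `1{E₁ ∩ … ∩ E_r ∈ A} 1{[E₁,…,E_r] > 0}` over all `r`-tuples of distinct flats
of `S`, divided by `r!`. -/
def intersectionProcess (r q : ℕ) (S : Set (Flat n k)) (A : Set (Flat n q)) : ℝ≥0∞ :=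
  (r ! : ℝ≥0∞)⁻¹ * ((distinctTuples r S ∩ intersectsIn A).encard : ℝ≥0∞)

/-- The intensity measure `Θ_(r)(A) = 𝔼 X_(r)(A)` of the `r`-th intersection process. -/
def intersectionIntensity (P : Measure Ω) (X : Ω → Set (Flat n k)) (r q : ℕ)
    (A : Set (Flat n q)) : ℝ≥0∞ :=
  ∫⁻ ω, intersectionProcess r q (X ω) A ∂P

end Processes

/-- The kernel `1{L₁ ∩ … ∩ L_r ∈ A} [L₁,…,L_r]`. -/
def intersectionKernel {n k r q : ℕ} (A : Set (Grassmannian n q)) (L : Fin r → Grassmannian n k) :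
    ℝ≥0∞ :=
  open Classical in
  if ∃ M ∈ A, M.1 = ⨅ i, (L i).1 then ENNReal.ofReal (subspaceDet fun i => (L i).1) else 0

end FlatProcesses

end

noncomputable section

namespace FlatProcesses

open Filter Topology

variable {n k : ℕ}

/-! Type (S_r) turns the expected number of intersecting `r`-tuples into the mass that the product
measure `Θ^r` gives to `intersectsIn A`. Inserting the representation of `Θ`
(`HasIntensityAndDirection.pi_apply`) leaves, for fixed directions `L₁,…,L_r`, the Lebesgue volume
of the translation vectors in `∏ Lᵢᗮ` whose flats meet in an element of `A`. In general position let
`M = ⋂ Lᵢ`. Then `Mᗮ` is the direct sum of the `Lᵢᗮ`, and `z ↦ (projection of z to Lᵢᗮ)ᵢ` is a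
linear bijection from `Mᗮ` to `∏ Lᵢᗮ` with Jacobian `[L₁,…,L_r]`. The flats `Lᵢ + z` meet exactly in
`M + z`, so the volume is `[L₁,…,L_r]` times that of `{z ∈ Mᗮ | M + z ∈ A}` (`volume_intersectsIn`).
Tuples not in general position contribute nothing. Hence the intersection process has the required
form, its direction measure being the image of `[L₁,…,L_r] Q^r` under intersection, up to `γ^r /
r!`. Flats meeting the unit ball with direction in `A` serve as test sets: every intensity and
directional distribution give them mass `γ_(r) Q_(r)(A)` times a ball volume. Measurability rests on
two devices: the projection to `⋂ Lᵢ` is a limit of ergodic averages of the mean of the projections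
to the `Lᵢ`, and Lebesgue measure on the varying spaces `Lᵢᗮ` is replaced by Lebesgue measure on
tubes in the fixed space `ℝⁿ`. -/

/-! ### Borel structure of `G(n,k)` and `A(n,k)`; flats as pairs of direction and foot. -/

theorem Grassmannian.isInducing_starProjection :
    IsInducing (fun L : Grassmannian n k => L.1.starProjection) := ⟨rfl⟩

theorem Flat.isInducing_dir_foot :
    IsInducing (fun F : Flat n k => (F.dir, F.foot)) := ⟨rfl⟩

instance : SecondCountableTopology (Space n →L[ℝ] Space n) :=
  haveI : ProperSpace (Space n →L[ℝ] Space n) := FiniteDimensional.proper ℝ _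
  secondCountable_of_proper

instance : SecondCountableTopology (Grassmannian n k) :=
  Grassmannian.isInducing_starProjection.secondCountableTopology

/-- A map into the endomorphisms of `ℝⁿ` is measurable if it is so pointwise. -/
theorem measurable_endomorphism {α : Type*} [MeasurableSpace α]
    {f : α → Space n →L[ℝ] Space n} (hf : ∀ x, Measurable fun a => f a x) : Measurable f := by
  -- An endomorphism is a continuous linear function of its values on the standard basis.
  have h : f = fun a => ∑ i : Fin n,
      ContinuousLinearMap.smulRightL ℝ (Space n) (Space n)
        (innerSL ℝ (EuclideanSpace.basisFun (Fin n) ℝ i))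
        (f a (EuclideanSpace.basisFun (Fin n) ℝ i)) := by
    funext a
    ext1 x
    have hx := (EuclideanSpace.basisFun (Fin n) ℝ).sum_repr' x
    conv_lhs => rw [← hx, map_sum]
    simp
  rw [h]
  exact Finset.measurable_sum _ fun i _ =>
    (ContinuousLinearMap.continuous _).measurable.comp (hf _)

theorem Grassmannian.measurable_of_starProjection {α : Type*} [MeasurableSpace α]
    {f : α → Grassmannian n k} (hf : ∀ x, Measurable fun a => (f a).1.starProjection x) :
    Measurable f := by
  have h : (inferInstance : MeasurableSpace (Grassmannian n k)) =
      MeasurableSpace.comap (fun L => L.1.starProjection) (borel _) := borel_comap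
  change Measurable[_, inferInstance] f
  rw [h]
  exact measurable_comap_iff.mpr (measurable_endomorphism hf)

theorem Flat.measurable_of_dir_foot {α : Type*} [MeasurableSpace α]
    {f : α → Flat n k} (hd : Measurable fun a => (f a).dir) (hf : Measurable fun a => (f a).foot) :
    Measurable f := by
  have h : (inferInstance : MeasurableSpace (Flat n k)) =
      MeasurableSpace.comap (fun F => (F.dir, F.foot)) (borel _) := borel_comap
  change Measurable[_, inferInstance] f
  rw [h]
  refine measurable_comap_iff.mpr ?_
  rw [← BorelSpace.measurable_eq (α := Grassmannian n k × Space n)]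
  exact hd.prodMk hf

@[fun_prop]
theorem Flat.measurable_dir : Measurable (Flat.dir : Flat n k → _) :=
  (continuous_fst.comp Flat.isInducing_dir_foot.continuous).measurable

@[fun_prop]
theorem Flat.measurable_foot : Measurable (Flat.foot : Flat n k → _) :=
  (continuous_snd.comp Flat.isInducing_dir_foot.continuous).measurable

theorem Grassmannian.continuous_starProjection_apply :
    Continuous fun p : Grassmannian n k × Space n => p.1.1.starProjection p.2 :=
  (Grassmannian.isInducing_starProjection.continuous.comp continuous_fst).clm_apply continuous_snd

theorem Grassmannian.measurable_starProjection_apply {α : Type*} [MeasurableSpace α]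
    {f : α → Grassmannian n k} {g : α → Space n} (hf : Measurable f) (hg : Measurable g) :
    Measurable fun a => (f a).1.starProjection (g a) := by
  have h := Grassmannian.continuous_starProjection_apply.measurable.comp (hf.prodMk hg)
  simpa only [Function.comp_def] using h

theorem Flat.ext_dir_foot {F G : Flat n k} (hd : F.dir = G.dir) (hf : F.foot = G.foot) :
    F = G := by
  have : Nonempty F.1 := F.2.1.to_subtype
  have : Nonempty G.1 := G.2.1.to_subtype
  refine Subtype.ext (AffineSubspace.ext_of_direction_eq (congrArg Subtype.val hd) ⟨F.foot, ?_, ?_⟩)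
  · exact EuclideanGeometry.orthogonalProjection_mem _
  · rw [hf]; exact EuclideanGeometry.orthogonalProjection_mem _

theorem Flat.foot_mem (F : Flat n k) : F.foot ∈ F.1 := by
  have : Nonempty F.1 := F.2.1.to_subtype
  exact EuclideanGeometry.orthogonalProjection_mem _

/-- The foot of a flat is the component orthogonal to the direction of each of its points. -/
theorem Flat.foot_eq {F : Flat n k} {x : Space n} (hx : x ∈ F.1) :
    F.foot = x - F.1.direction.starProjection x := by
  have : Nonempty F.1 := F.2.1.to_subtype
  refine EuclideanGeometry.coe_orthogonalProjection_eq_iff_mem.mpr ⟨?_, ?_⟩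
  · have := AffineSubspace.vadd_mem_of_mem_direction
      (neg_mem (F.1.direction.starProjection_apply_mem x)) hx
    rwa [vadd_eq_add, neg_add_eq_sub] at this
  · rw [vsub_eq_sub, zero_sub]
    exact neg_mem (Submodule.sub_starProjection_mem_orthogonal x)

theorem Flat.starProjection_foot (F : Flat n k) : F.dir.1.starProjection F.foot = 0 := by
  have := Flat.foot_eq F.foot_mem
  change F.1.direction.starProjection F.foot = 0
  exact sub_eq_self.mp this.symm

@[simp]
theorem Flat.dir_ofDir (L : Grassmannian n k) (x : Space n) : (Flat.ofDir L x).dir = L :=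
  Subtype.ext (AffineSubspace.direction_mk' _ _)

theorem Flat.foot_ofDir (L : Grassmannian n k) (x : Space n) :
    (Flat.ofDir L x).foot = x - L.1.starProjection x := by
  rw [Flat.foot_eq (F := Flat.ofDir L x) (x := x) (AffineSubspace.self_mem_mk' _ _)]
  have h : (Flat.ofDir L x).1.direction = L.1 := AffineSubspace.direction_mk' _ _
  simp only [h]

theorem Flat.measurable_ofDir {α : Type*} [MeasurableSpace α]
    {f : α → Grassmannian n k} {g : α → Space n} (hf : Measurable f) (hg : Measurable g) :
    Measurable fun a => Flat.ofDir (f a) (g a) := by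
  refine Flat.measurable_of_dir_foot (by simpa using hf) ?_
  simp only [Flat.foot_ofDir]
  exact hg.sub (Grassmannian.measurable_starProjection_apply hf hg)

theorem Flat.ofDir_dir {F : Flat n k} {x : Space n} (hx : x ∈ F.1) : Flat.ofDir F.dir x = F :=
  Flat.ext_dir_foot (by simp) (by rw [Flat.foot_ofDir, Flat.foot_eq hx]; rfl)

theorem Flat.translate_ofDir (z : Space n) (L : Grassmannian n k) (x : Space n) :
    Flat.translate z (Flat.ofDir L x) = Flat.ofDir L (x + (z - L.1.starProjection z)) := by
  have hd : (Flat.translate z (Flat.ofDir L x)).dir = L :=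
    Subtype.ext ((AffineSubspace.pointwise_vadd_direction _ _).trans
      (AffineSubspace.direction_mk' _ _))
  have hm : z + x ∈ (Flat.translate z (Flat.ofDir L x)).1 :=
    AffineSubspace.vadd_mem_pointwise_vadd_iff.mpr (AffineSubspace.self_mem_mk' _ _)
  rw [← Flat.ofDir_dir hm, hd]
  refine Flat.ext_dir_foot (by simp) ?_
  have h : L.1.starProjection (L.1.starProjection z) = L.1.starProjection z :=
    Submodule.starProjection_eq_self_iff.mpr (Submodule.starProjection_apply_mem _ _)
  simp only [Flat.foot_ofDir, map_add, map_sub, h]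
  abel

theorem Flat.measurable_translate (z : Space n) :
    Measurable (Flat.translate z : Flat n k → Flat n k) := by
  have h : (Flat.translate z : Flat n k → Flat n k) =
      fun F => Flat.ofDir F.dir (F.foot + (z - F.dir.1.starProjection z)) := by
    funext F
    rw [← Flat.translate_ofDir, Flat.ofDir_dir F.foot_mem]
  rw [h]
  exact Flat.measurable_ofDir Flat.measurable_dir (Flat.measurable_foot.add
    (measurable_const.sub
      (Grassmannian.measurable_starProjection_apply Flat.measurable_dir measurable_const)))

/-- A measure with an intensity and a directional distribution is translation invariant. -/
theorem HasIntensityAndDirection.isTranslationInvariant {Θ : Set (Flat n k) → ℝ≥0∞} {γ : ℝ≥0}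
    {Q : Measure (Grassmannian n k)} (h : HasIntensityAndDirection Θ γ Q) :
    IsTranslationInvariant Θ := by
  intro z A hA
  rw [h.2 _ (Flat.measurable_translate z hA), h.2 A hA]
  congr 2
  funext L
  -- Translating by `z` shifts the parameter in `Lᗮ` by the component of `z` orthogonal to `L`, and
  -- Lebesgue measure on `Lᗮ` is invariant under this shift.
  have hz : z - L.1.starProjection z ∈ (L.1)ᗮ := Submodule.sub_starProjection_mem_orthogonal z
  have : {x : (L.1)ᗮ | Flat.ofDir L (x : Space n) ∈ Flat.translate z ⁻¹' A} =
      (fun x => x + (⟨_, hz⟩ : (L.1)ᗮ)) ⁻¹' {x : (L.1)ᗮ | Flat.ofDir L (x : Space n) ∈ A} := by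
    ext x
    simp [Flat.translate_ofDir]
  rw [this, measure_preimage_add_right]

theorem Flat.hitting_eq_iUnion (C : Set (Space n)) :
    (Flat.hitting C : Set (Flat n k)) =
      {F | ∃ x ∈ C, x - F.dir.1.starProjection x = F.foot} := by
  ext F
  constructor
  · rintro ⟨x, hx, hC⟩
    exact ⟨x, hC, (Flat.foot_eq hx).symm⟩
  · rintro ⟨x, hC, hx⟩
    refine ⟨x, ?_, hC⟩
    have : Flat.ofDir F.dir x = F :=
      Flat.ext_dir_foot (by simp) (by rw [Flat.foot_ofDir, hx])
    rw [← this]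
    exact AffineSubspace.self_mem_mk' _ _

/-- The relation `x ∈ F` is closed in `C × A(n,k)`, and projecting along the compact factor `C`
preserves closedness. Hitting sets are therefore Borel. -/
theorem Flat.isClosed_hitting {C : Set (Space n)} (hC : IsCompact C) :
    IsClosed (Flat.hitting C : Set (Flat n k)) := by
  rw [Flat.hitting_eq_iUnion]
  have : CompactSpace C := isCompact_iff_compactSpace.mp hC
  have hdir : Continuous (Flat.dir : Flat n k → _) :=
    continuous_fst.comp Flat.isInducing_dir_foot.continuous
  have hfoot : Continuous (Flat.foot : Flat n k → _) :=
    continuous_snd.comp Flat.isInducing_dir_foot.continuous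
  have hcl : IsClosed {p : C × Flat n k |
      (p.1 : Space n) - p.2.dir.1.starProjection p.1 = p.2.foot} := by
    refine isClosed_eq ?_ (hfoot.comp continuous_snd)
    exact (continuous_subtype_val.comp continuous_fst).sub
      ((Grassmannian.isInducing_starProjection.continuous.comp
        (hdir.comp continuous_snd)).clm_apply (continuous_subtype_val.comp continuous_fst))
  have := isClosedMap_snd_of_compactSpace _ hcl
  convert this using 1
  ext F
  constructor
  · rintro ⟨x, hx, h⟩
    exact ⟨(⟨x, hx⟩, F), h, rfl⟩
  · rintro ⟨⟨x, G⟩, h, rfl⟩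
    exact ⟨x, x.2, h⟩

theorem Flat.mem_hitting_closedBall {F : Flat n k} {ρ : ℝ} (h : ‖F.foot‖ ≤ ρ) :
    F ∈ (Flat.hitting (Metric.closedBall 0 ρ) : Set (Flat n k)) :=
  ⟨F.foot, F.foot_mem, by simpa using h⟩

theorem Grassmannian.nonempty (h : k ≤ n) : Nonempty (Grassmannian n k) := by
  obtain ⟨f, hf⟩ := exists_linearIndependent_of_le_finrank (R := ℝ) (M := Space n) (n := k)
    (by simpa using h)
  exact ⟨⟨Submodule.span ℝ (Set.range f), by rw [finrank_span_eq_card hf, Fintype.card_fin]⟩⟩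

/-! ### Intersections depend measurably on the intersected flats. -/

variable {r q : ℕ}

/-- The average of the orthogonal projections to finitely many subspaces. -/
def averageProjection (L : Fin r → Submodule ℝ (Space n)) : Space n →L[ℝ] Space n :=
  (r : ℝ)⁻¹ • ∑ i, (L i).starProjection

theorem averageProjection_apply (L : Fin r → Submodule ℝ (Space n)) (x : Space n) :
    averageProjection L x = (r : ℝ)⁻¹ • ∑ i, (L i).starProjection x := by
  simp [averageProjection]

theorem norm_averageProjection_le (L : Fin r → Submodule ℝ (Space n)) :
    ‖averageProjection L‖ ≤ 1 := by
  have h : ‖∑ i, (L i).starProjection‖ ≤ r := by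
    refine (norm_sum_le_of_le _ fun i _ => (L i).starProjection_norm_le).trans ?_
    simp
  rw [averageProjection, norm_smul, norm_inv, Real.norm_natCast]
  exact (mul_le_mul_of_nonneg_left h (by positivity)).trans (inv_mul_le_one)

/-- Since `⟨Pᵢ x, x⟩ = ‖Pᵢ x‖² ≤ ‖x‖²`, a fixed point of the average makes the nonnegative defects
`‖x‖² - ‖Pᵢ x‖²` sum to zero. Each of them vanishes, so `x` lies in every `L i`. -/
theorem averageProjection_eq_self_iff (hr : r ≠ 0) (L : Fin r → Submodule ℝ (Space n))
    (x : Space n) : averageProjection L x = x ↔ x ∈ ⨅ i, L i := by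
  have hr' : (r : ℝ) ≠ 0 := Nat.cast_ne_zero.mpr hr
  rw [Submodule.mem_iInf]
  constructor
  · intro h
    have hs : ∑ i, (L i).starProjection x = (r : ℝ) • x := by
      rw [averageProjection_apply] at h
      rw [← smul_right_injective _ hr' |>.eq_iff.mpr h, smul_inv_smul₀ hr']
    have hi : ∀ i, inner ℝ ((L i).starProjection x) x = ‖(L i).starProjection x‖ ^ 2 := fun i => by
      simpa using Submodule.re_inner_starProjection_eq_normSq (𝕜 := ℝ) (K := L i) x
    have h0 : ∑ i, (‖x‖ ^ 2 - ‖(L i).starProjection x‖ ^ 2) = 0 := by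
      simp only [← hi, Finset.sum_sub_distrib, ← sum_inner, hs, inner_smul_left,
        real_inner_self_eq_norm_sq]
      simp
    have hle : ∀ i, ‖(L i).starProjection x‖ ≤ ‖x‖ := fun i =>
      Submodule.norm_starProjection_apply_le _ _
    have h1 := (Finset.sum_eq_zero_iff_of_nonneg fun i _ =>
      sub_nonneg.mpr (pow_le_pow_left₀ (norm_nonneg _) (hle i) 2)).mp h0
    intro i
    refine (Submodule.mem_iff_norm_starProjection (𝕜 := ℝ) (L i) x).mpr ?_
    have h2 := sub_eq_zero.mp (h1 i (Finset.mem_univ i))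
    exact (sq_eq_sq₀ (norm_nonneg _) (norm_nonneg _)).mp h2.symm
  · intro h
    rw [averageProjection_apply]
    simp only [Submodule.starProjection_eq_self_iff.mpr (h _)]
    simp [← Nat.cast_smul_eq_nsmul ℝ, smul_smul, hr']

/-- Von Neumann's mean ergodic theorem for the contraction `averageProjection L`. It exhibits the
projection to the intersection as a limit of expressions in the single projections. -/
theorem tendsto_birkhoffAverage_averageProjection (hr : r ≠ 0)
    (L : Fin r → Submodule ℝ (Space n)) (x : Space n) :
    Tendsto (birkhoffAverage ℝ (averageProjection L) _root_.id · x) atTop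
      (𝓝 ((⨅ i, L i).starProjection x)) := by
  have h := (averageProjection L).tendsto_birkhoffAverage_orthogonalProjection
    (norm_averageProjection_le L) x
  have he : (averageProjection L).eqLocus (1 : Space n →L[ℝ] Space n) = ⨅ i, L i := by
    ext y
    exact averageProjection_eq_self_iff hr L y
  have hM : ∀ {M N : Submodule ℝ (Space n)} [M.HasOrthogonalProjection], M = N →
      ((M.orthogonalProjectionOnto x : M) : Space n) = N.starProjection x := by
    rintro M N _ rfl
    rfl
  rwa [hM he] at h

/-- Averaging the iterates of `w ↦ averageProjection L w + c` finds its fixed points. -/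
theorem tendsto_birkhoffAverage_averageProjection_add (hr : r ≠ 0)
    (L : Fin r → Submodule ℝ (Space n)) {c z : Space n} (hz : averageProjection L z + c = z)
    (x : Space n) :
    Tendsto (birkhoffAverage ℝ (fun w => averageProjection L w + c) _root_.id · x) atTop
      (𝓝 (z + (⨅ i, L i).starProjection (x - z))) := by
  -- Seen from the fixed point `z`, the affine map is the linear contraction.
  have hit : ∀ j, (fun w => averageProjection L w + c)^[j] x =
      z + (averageProjection L)^[j] (x - z) := by
    intro j
    induction j with
    | zero => simp
    | succ j ih =>
      rw [Function.iterate_succ_apply', Function.iterate_succ_apply', ih]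
      simp only [map_add]
      nth_rw 3 [← hz]
      abel
  refine Tendsto.congr' ?_
    ((tendsto_birkhoffAverage_averageProjection hr L (x - z)).const_add z)
  filter_upwards [eventually_ne_atTop 0] with m hm
  have hm' : (m : ℝ) ≠ 0 := Nat.cast_ne_zero.mpr hm
  simp only [birkhoffAverage, birkhoffSum, hit, _root_.id, Finset.sum_add_distrib, smul_add,
    Finset.sum_const, Finset.card_range]
  rw [← Nat.cast_smul_eq_nsmul ℝ, inv_smul_smul₀ hm']

theorem measurable_birkhoffAverage_averageProjection_add {α : Type*} [MeasurableSpace α]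
    {L : α → Fin r → Grassmannian n k} {c x : α → Space n} (hL : ∀ i, Measurable fun a => L a i)
    (hc : Measurable c) (hx : Measurable x) (m : ℕ) :
    Measurable fun a => birkhoffAverage ℝ
      (fun w => averageProjection (fun i => (L a i).1) w + c a) _root_.id m (x a) := by
  have hit : ∀ j, Measurable fun a =>
      (fun w => averageProjection (fun i => (L a i).1) w + c a)^[j] (x a) := by
    intro j
    induction j with
    | zero => simpa using hx
    | succ j ih =>
      simp only [Function.iterate_succ_apply', averageProjection_apply]
      simp only [averageProjection_apply] at ih
      refine Measurable.add (Measurable.fun_const_smul (Finset.measurable_sum _ fun i _ => ?_) _) hc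
      exact Grassmannian.measurable_starProjection_apply (hL i) ih
  simp only [birkhoffAverage, birkhoffSum, _root_.id]
  exact Measurable.fun_const_smul (Finset.measurable_sum _ fun i _ => hit i) _

theorem measurable_starProjection_iInf {α : Type*} [MeasurableSpace α] (hr : r ≠ 0)
    {L : α → Fin r → Grassmannian n k} (hL : ∀ i, Measurable fun a => L a i) (x : Space n) :
    Measurable fun a => (⨅ i, (L a i).1).starProjection x := by
  refine measurable_of_tendsto_metrizable
    (measurable_birkhoffAverage_averageProjection_add hL (measurable_const (a := (0 : Space n)))
      (measurable_const (a := x)))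
    (tendsto_pi_nhds.mpr fun a => ?_)
  simpa using tendsto_birkhoffAverage_averageProjection_add hr (fun i => (L a i).1)
    (c := 0) (z := 0) (by simp) x

/-- The dimension of a subspace is the trace of its orthogonal projection. -/
theorem measurable_finrank_iInf {α : Type*} [MeasurableSpace α] (hr : r ≠ 0)
    {L : α → Fin r → Grassmannian n k} (hL : ∀ i, Measurable fun a => L a i) :
    Measurable fun a => (Module.finrank ℝ (⨅ i, (L a i).1 : Submodule ℝ (Space n)) : ℝ) := by
  have h : ∀ M : Submodule ℝ (Space n), (Module.finrank ℝ M : ℝ) =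
      ∑ j, inner ℝ (EuclideanSpace.basisFun (Fin n) ℝ j)
        (M.starProjection (EuclideanSpace.basisFun (Fin n) ℝ j)) := by
    intro M
    have hp : LinearMap.IsProj M (M.starProjection : Space n →ₗ[ℝ] Space n) :=
      ⟨fun x => M.starProjection_apply_mem x,
        fun x hx => Submodule.starProjection_eq_self_iff.mpr hx⟩
    rw [← hp.trace, LinearMap.trace_eq_sum_inner _ (EuclideanSpace.basisFun (Fin n) ℝ)]
    rfl
  simp only [h]
  exact Finset.measurable_sum _ fun j _ =>
    measurable_const.inner (measurable_starProjection_iInf hr hL _)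

/-- The intersection of subspaces depends measurably on them where its dimension is constant. -/
theorem Grassmannian.measurable_iInf {α : Type*} [MeasurableSpace α] (hr : r ≠ 0)
    {L : α → Fin r → Grassmannian n k} (hL : ∀ i, Measurable fun a => L a i)
    {M : α → Grassmannian n q} (hM : ∀ a, (M a).1 = ⨅ i, (L a i).1) : Measurable M := by
  refine Grassmannian.measurable_of_starProjection fun x => ?_
  simp only [hM]
  exact measurable_starProjection_iInf hr hL x

theorem iInf_mk' {ι : Type*} (L : ι → Submodule ℝ (Space n)) (z : Space n) :
    ⨅ i, AffineSubspace.mk' z (L i) = AffineSubspace.mk' z (⨅ i, L i) := by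
  ext x
  simp [AffineSubspace.mem_iInf_iff, AffineSubspace.mem_mk', Submodule.mem_iInf]

theorem Flat.eq_mk' {F : Flat n k} {z : Space n} (hz : z ∈ F.1) :
    F.1 = AffineSubspace.mk' z F.dir.1 :=
  (congrArg Subtype.val (Flat.ofDir_dir hz)).symm

theorem Flat.iInf_eq_mk' {E : Fin r → Flat n k} {z : Space n} (hz : ∀ i, z ∈ (E i).1) :
    ⨅ i, (E i).1 = AffineSubspace.mk' z (⨅ i, (E i).dir.1) := by
  rw [← iInf_mk']
  exact iInf_congr fun i => Flat.eq_mk' (hz i)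

theorem Flat.dir_eq_iInf {E : Fin r → Flat n k} {F : Flat n q} (hF : F.1 = ⨅ i, (E i).1) :
    F.dir.1 = ⨅ i, (E i).dir.1 := by
  have hz : ∀ i, F.foot ∈ (E i).1 := by
    have := F.foot_mem
    rw [hF] at this
    exact fun i => (iInf_le (fun i => (E i).1) i) this
  change F.1.direction = _
  rw [hF, Flat.iInf_eq_mk' hz, AffineSubspace.direction_mk']

/-- The intersection of flats depends measurably on them where its dimension is constant. -/
theorem Flat.measurable_iInf {α : Type*} [MeasurableSpace α] (hr : r ≠ 0)
    {E : α → Fin r → Flat n k} (hE : ∀ i, Measurable fun a => E a i)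
    {F : α → Flat n q} (hF : ∀ a, (F a).1 = ⨅ i, (E a i).1) : Measurable F := by
  have hdir : ∀ a, (F a).dir.1 = ⨅ i, (E a i).dir.1 := fun a => Flat.dir_eq_iInf (hF a)
  refine Flat.measurable_of_dir_foot (Grassmannian.measurable_iInf hr
    (fun i => Flat.measurable_dir.comp (hE i)) hdir) ?_
  have hr' : (r : ℝ) ≠ 0 := Nat.cast_ne_zero.mpr hr
  -- The affine map is the mean of the orthogonal projections to the flats `E a i`, and it fixes
  -- their common points. Its averages started at `0` converge to the projection of `0` to the
  -- intersection, which is the foot.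
  refine measurable_of_tendsto_metrizable
    (measurable_birkhoffAverage_averageProjection_add
      (fun i => Flat.measurable_dir.comp (hE i))
      (c := fun a => (r : ℝ)⁻¹ • ∑ i, (E a i).foot)
      (Measurable.fun_const_smul (Finset.measurable_sum _ fun i _ =>
        Flat.measurable_foot.comp (hE i)) _) (measurable_const (a := (0 : Space n))))
    (tendsto_pi_nhds.mpr fun a => ?_)
  have hz : ∀ i, (F a).foot ∈ (E a i).1 := by
    have := (F a).foot_mem
    rw [hF a] at this
    exact fun i => (iInf_le (fun i => (E a i).1) i) this
  have hfix : averageProjection (fun i => (E a i).dir.1) (F a).foot +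
      (r : ℝ)⁻¹ • ∑ i, (E a i).foot = (F a).foot := by
    rw [averageProjection_apply, ← smul_add, ← Finset.sum_add_distrib]
    have : ∀ i, (E a i).dir.1.starProjection (F a).foot + (E a i).foot = (F a).foot := fun i => by
      rw [Flat.foot_eq (hz i)]
      exact add_sub_cancel _ _
    simp [this, ← Nat.cast_smul_eq_nsmul ℝ, smul_smul, hr']
  have h := tendsto_birkhoffAverage_averageProjection_add hr (fun i => (E a i).dir.1) hfix 0
  rw [← hdir a, zero_sub, map_neg, Flat.starProjection_foot, neg_zero, add_zero] at h
  exact h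

/-! ### The subspace determinant as a Jacobian. -/

section SpanVolume

variable (K : Fin r → Submodule ℝ (Space n))

/-- The union of orthonormal bases of the subspaces `K i`. -/
def unionBasis (p : (i : Fin r) × Fin (Module.finrank ℝ (K i))) : Space n :=
  ((stdOrthonormalBasis ℝ (K p.1) p.2 : K p.1) : Space n)

theorem unionBasis_mem (p : (i : Fin r) × Fin (Module.finrank ℝ (K i))) :
    unionBasis K p ∈ K p.1 := Subtype.property _

theorem spanVolume_eq : spanVolume K = √(Matrix.gram ℝ (unionBasis K)).det := rfl

theorem span_unionBasis : Submodule.span ℝ (Set.range (unionBasis K)) = ⨆ i, K i := by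
  apply le_antisymm
  · rw [Submodule.span_le]
    rintro _ ⟨p, rfl⟩
    exact (le_iSup K p.1) (unionBasis_mem K p)
  · refine iSup_le fun i x hx => ?_
    have h := (stdOrthonormalBasis ℝ (K i)).sum_repr ⟨x, hx⟩
    have h' := congrArg (Subtype.val) h
    rw [← show _ = x from h', Submodule.coe_sum]
    refine Submodule.sum_mem _ fun j _ => ?_
    rw [Submodule.coe_smul]
    exact Submodule.smul_mem _ _ (Submodule.subset_span ⟨⟨i, j⟩, rfl⟩)

/-- The volume spanned by orthonormal bases is positive if and only if the sum of the subspaces is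
direct. -/
theorem spanVolume_pos_iff : 0 < spanVolume K ↔
    Module.finrank ℝ (⨆ i, K i : Submodule ℝ (Space n)) = ∑ i, Module.finrank ℝ (K i) := by
  have h0 : 0 ≤ (Matrix.gram ℝ (unionBasis K)).det := (Matrix.posSemidef_gram ℝ _).det_nonneg
  rw [spanVolume_eq, Real.sqrt_pos, h0.lt_iff_ne', Matrix.det_gram_ne_zero_iff_linearIndependent,
    linearIndependent_iff_card_eq_finrank_span, Set.finrank, span_unionBasis]
  simp only [Fintype.card_sigma, Fintype.card_fin]
  exact eq_comm

theorem spanVolume_nonneg : 0 ≤ spanVolume K := Real.sqrt_nonneg _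

theorem measurePreserving_sigmaCurry {ι : Type*} [Fintype ι] {κ : ι → Type*}
    [∀ i, Fintype (κ i)] :
    MeasurePreserving (MeasurableEquiv.piCurry fun (i : ι) (_ : κ i) => ℝ) volume volume := by
  refine MeasurePreserving.symm
    (MeasurableEquiv.piCurry fun (i : ι) (_ : κ i) => ℝ).symm ⟨MeasurableEquiv.measurable _, ?_⟩
  refine (Measure.pi_eq fun s hs => ?_).symm
  rw [MeasurableEquiv.map_apply]
  have h : (MeasurableEquiv.piCurry fun (i : ι) (_ : κ i) => ℝ).symm ⁻¹' (Set.univ.pi s) =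
      Set.univ.pi fun i => Set.univ.pi fun j => s ⟨i, j⟩ := by
    ext x
    simp only [Set.mem_preimage, Set.mem_univ_pi, Sigma.forall]
    rfl
  rw [h, volume_pi_pi, Fintype.prod_sigma]
  simp only [volume_pi_pi]

/-- The vectors of the `K i` with given coordinates in their orthonormal bases. -/
def ofCoordinates (v : ((i : Fin r) × Fin (Module.finrank ℝ (K i))) → ℝ) : (i : Fin r) → K i :=
  fun i => (stdOrthonormalBasis ℝ (K i)).repr.symm (WithLp.toLp 2 fun j => v ⟨i, j⟩)

theorem measurePreserving_ofCoordinates :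
    MeasurePreserving (ofCoordinates K) volume volume := by
  have h := volume_preserving_pi (fun i => (stdOrthonormalBasis ℝ (K i)).measurePreserving_repr_symm.comp
    (PiLp.volume_preserving_toLp (Fin (Module.finrank ℝ (K i)))))
  exact h.comp measurePreserving_sigmaCurry

/-- In orthonormal coordinates the map from `W` to `∏ K i` has a matrix `A` whose rows are the
vectors of `unionBasis K`. Then `A Aᵀ` is their Gram matrix, so `|det A|` is `spanVolume K`. Keeping
`W` apart from the supremum allows `W = Mᗮ` later. -/
theorem volume_pi_eq_spanVolume_mul {W : Submodule ℝ (Space n)} (hW : W = ⨆ i, K i)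
    (hd : Module.finrank ℝ W = ∑ i, Module.finrank ℝ (K i)) {V : Set ((i : Fin r) → K i)}
    (hV : MeasurableSet V) :
    volume V = ENNReal.ofReal (spanVolume K) *
      volume {z : W | (fun i => (K i).orthogonalProjectionOnto (z : Space n)) ∈ V} := by
  have hcard : Fintype.card (Fin (Module.finrank ℝ W)) =
      Fintype.card ((i : Fin r) × Fin (Module.finrank ℝ (K i))) := by
    simp [Fintype.card_sigma, hd]
  -- Indexing the basis of `W` by the index set of `unionBasis K` makes `A` square.
  set e := (stdOrthonormalBasis ℝ W).reindex (Fintype.equivOfCardEq hcard) with he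
  set A : Matrix _ _ ℝ := Matrix.of fun p d => inner ℝ (unionBasis K p) (e d : Space n) with hA
  have hgram : A * A.transpose = Matrix.gram ℝ (unionBasis K) := by
    ext p p'
    have hp : ∀ p, unionBasis K p ∈ W := fun p => by
      rw [hW]
      exact le_iSup K p.1 (unionBasis_mem K p)
    have := e.sum_inner_mul_inner (⟨_, hp p⟩ : W) ⟨_, hp p'⟩
    rw [Matrix.mul_apply, Matrix.gram_apply]
    rw [Submodule.coe_inner] at this
    rw [← this]
    refine Finset.sum_congr rfl fun d _ => ?_
    rw [Matrix.transpose_apply, hA, Matrix.of_apply, Matrix.of_apply, Submodule.coe_inner,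
      Submodule.coe_inner, real_inner_comm (e d : Space n) (unionBasis K p')]
  have hdet : |A.det| = spanVolume K := by
    rw [spanVolume_eq, ← hgram, Matrix.det_mul, Matrix.det_transpose, Real.sqrt_mul_self_eq_abs]
  have hpos : 0 < spanVolume K := (spanVolume_pos_iff K).mpr (by rw [← hW, hd])
  have hA0 : A.det ≠ 0 := by
    rw [← abs_pos, hdet]
    exact hpos
  set f : (((i : Fin r) × Fin (Module.finrank ℝ (K i))) → ℝ) → W :=
    fun v => e.repr.symm (WithLp.toLp 2 v) with hf
  have hfm : MeasurePreserving f volume volume :=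
    e.measurePreserving_repr_symm.comp (PiLp.volume_preserving_toLp _)
  have hcomp : ∀ v, (fun i => (K i).orthogonalProjectionOnto (f v : Space n)) =
      ofCoordinates K (Matrix.toLin' A v) := by
    intro v
    funext i
    rw [ofCoordinates, ← LinearIsometryEquiv.symm_apply_eq, LinearIsometryEquiv.symm_symm]
    ext j
    have hv : (f v : Space n) = ∑ d, v d • (e d : Space n) := by
      have := congrArg Subtype.val (e.sum_repr_symm (WithLp.toLp 2 v))
      rw [hf, ← this, Submodule.coe_sum]
      rfl
    rw [OrthonormalBasis.repr_apply_apply, Submodule.inner_orthogonalProjectionOnto_eq_of_mem_left,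
      hv, inner_sum]
    simp only [inner_smul_right, Matrix.toLin'_apply, Matrix.mulVec, dotProduct, hA,
      Matrix.of_apply]
    exact Finset.sum_congr rfl fun d _ => mul_comm _ _
  have hmeas : Measurable fun z : W => (fun i => (K i).orthogonalProjectionOnto (z : Space n)) :=
    measurable_pi_lambda _ fun i =>
      ((K i).orthogonalProjectionOnto.continuous.comp continuous_subtype_val).measurable
  have h1 : volume {z : W | (fun i => (K i).orthogonalProjectionOnto (z : Space n)) ∈ V} =
      ENNReal.ofReal |A.det⁻¹| * volume V := by
    have hT : MeasurableSet {z : W |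
        (fun i => (K i).orthogonalProjectionOnto (z : Space n)) ∈ V} := hmeas hV
    rw [← hfm.measure_preimage hT.nullMeasurableSet]
    have : f ⁻¹' {z : W | (fun i => (K i).orthogonalProjectionOnto (z : Space n)) ∈ V} =
        Matrix.toLin' A ⁻¹' (ofCoordinates K ⁻¹' V) := by
      ext v
      simp only [Set.mem_preimage, Set.mem_ofPred_eq, hcomp]
    rw [this, ← Measure.map_apply (LinearMap.continuous_of_finiteDimensional _).measurable
      ((measurePreserving_ofCoordinates K).measurable hV),
      Real.map_matrix_volume_pi_eq_smul_volume_pi hA0, Measure.smul_apply, smul_eq_mul,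
      (measurePreserving_ofCoordinates K).measure_preimage hV.nullMeasurableSet]
  rw [h1, ← mul_assoc, abs_inv, hdet, ← ENNReal.ofReal_mul hpos.le, mul_inv_cancel₀ hpos.ne',
    ENNReal.ofReal_one, one_mul]

/-- If the sum of the subspaces `K i` is direct, then a vector of it can be prescribed by its
projections to the `K i`. -/
theorem exists_starProjection_eq
    (hd : Module.finrank ℝ (⨆ i, K i : Submodule ℝ (Space n)) = ∑ i, Module.finrank ℝ (K i))
    (x : (i : Fin r) → K i) : ∃ z, ∀ i, (K i).starProjection z = x i := by
  set S : (⨆ i, K i : Submodule ℝ (Space n)) →ₗ[ℝ] (i : Fin r) → K i :=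
    LinearMap.pi fun i => ((K i).orthogonalProjectionOnto : Space n →ₗ[ℝ] K i) ∘ₗ
      (⨆ i, K i : Submodule ℝ (Space n)).subtype with hS
  -- A vector of `⨆ K i` orthogonal to every `K i` is orthogonal to itself; equality of dimensions
  -- then gives surjectivity.
  have hinj : Function.Injective S := by
    refine (injective_iff_map_eq_zero S).mpr fun z hz => ?_
    have h : (z : Space n) ∈ (⨆ i, K i)ᗮ := by
      rw [← Submodule.iInf_orthogonal, Submodule.mem_iInf]
      intro i
      exact Submodule.orthogonalProjectionOnto_eq_zero_iff.mp (congrFun hz i)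
    exact Subtype.ext ((inner_self_eq_zero (𝕜 := ℝ)).mp ((Submodule.mem_orthogonal _ _).mp h _ z.2))
  obtain ⟨z, hz⟩ := (LinearMap.injective_iff_surjective_of_finrank_eq_finrank
    (by rw [hd, Module.finrank_pi_fintype])).mp hinj x
  exact ⟨z, fun i => congrArg Subtype.val (congrFun hz i)⟩

end SpanVolume

/-! ### General position and intersections of expected dimension. -/

theorem subspaceDet_eq (hrk : (r - 1) * n ≤ r * k) (L : Fin r → Grassmannian n k) :
    subspaceDet (fun i => (L i).1) = spanVolume fun i => (L i).1ᗮ := by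
  have h : ∑ i, Module.finrank ℝ (L i).1 = r * k := by
    simp only [fun i => (L i).2, Finset.sum_const, Finset.card_univ, Fintype.card_fin, smul_eq_mul]
  rw [subspaceDet, if_pos (h ▸ hrk)]

theorem iSup_orthogonal_eq {ι : Type*} (L : ι → Submodule ℝ (Space n)) :
    ⨆ i, (L i)ᗮ = (⨅ i, L i)ᗮ := by
  have h := Submodule.iInf_orthogonal fun i => (L i)ᗮ
  simp only [Submodule.orthogonal_orthogonal] at h
  rw [h, Submodule.orthogonal_orthogonal]

theorem Grassmannian.finrank_orthogonal (L : Grassmannian n k) :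
    Module.finrank ℝ (L.1)ᗮ = n - k := by
  have := L.1.finrank_add_finrank_orthogonal
  rw [L.2, finrank_euclideanSpace_fin] at this
  omega

theorem Grassmannian.le (L : Grassmannian n k) : k ≤ n := by
  have := L.1.finrank_le
  rwa [L.2, finrank_euclideanSpace_fin] at this

theorem subspaceDet_nonneg (hrk : (r - 1) * n ≤ r * k) (L : Fin r → Grassmannian n k) :
    0 ≤ subspaceDet fun i => (L i).1 := by
  rw [subspaceDet_eq hrk]
  exact spanVolume_nonneg _

/-- Codimension count: the sum of the complements is the complement of the intersection, and `r (n -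
k) = n - q`. -/
theorem finrank_iInf_eq_iff (hr : r ≠ 0) (hrk : (r - 1) * n ≤ r * k)
    (hq : q = r * k - (r - 1) * n) (L : Fin r → Grassmannian n k) :
    Module.finrank ℝ (⨅ i, (L i).1 : Submodule ℝ (Space n)) = q ↔
      Module.finrank ℝ (⨆ i, (L i).1ᗮ : Submodule ℝ (Space n)) =
        ∑ i, Module.finrank ℝ ((L i).1ᗮ : Submodule ℝ (Space n)) := by
  have hkn : k ≤ n := (L ⟨0, Nat.pos_of_ne_zero hr⟩).le
  have h := (⨅ i, (L i).1 : Submodule ℝ (Space n)).finrank_add_finrank_orthogonal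
  rw [finrank_euclideanSpace_fin] at h
  simp only [Grassmannian.finrank_orthogonal, Finset.sum_const, Finset.card_univ, Fintype.card_fin,
    smul_eq_mul]
  rw [iSup_orthogonal_eq]
  have h1 : r * (n - k) + r * k = r * n := by rw [← mul_add, Nat.sub_add_cancel hkn]
  have h2 : (r - 1) * n + n = r * n := by
    rw [← Nat.succ_mul, Nat.succ_eq_add_one, Nat.sub_add_cancel (Nat.pos_of_ne_zero hr)]
  omega

/-- The subspaces are in general position if and only if their intersection has the expected
dimension. -/
theorem subspaceDet_pos_iff (hr : r ≠ 0) (hrk : (r - 1) * n ≤ r * k)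
    (hq : q = r * k - (r - 1) * n) (L : Fin r → Grassmannian n k) :
    0 < subspaceDet (fun i => (L i).1) ↔
      Module.finrank ℝ (⨅ i, (L i).1 : Submodule ℝ (Space n)) = q := by
  rw [subspaceDet_eq hrk, spanVolume_pos_iff, finrank_iInf_eq_iff hr hrk hq]

/-- A common point is a `z` whose projection to each `(E i).dirᗮ` is the foot of `E i`. It exists
because these complements form a direct sum, so only the directions matter. -/
theorem Flat.exists_eq_iInf (hr : r ≠ 0) (hrk : (r - 1) * n ≤ r * k)
    (hq : q = r * k - (r - 1) * n) (E : Fin r → Flat n k)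
    (hE : Module.finrank ℝ (⨅ i, (E i).dir.1 : Submodule ℝ (Space n)) = q) :
    ∃ F : Flat n q, F.1 = ⨅ i, (E i).1 := by
  have hfoot : ∀ i, (E i).foot ∈ ((E i).dir.1)ᗮ := fun i =>
    (Submodule.starProjection_apply_eq_zero_iff _).mp (E i).starProjection_foot
  obtain ⟨z, hz⟩ := exists_starProjection_eq (fun i => ((E i).dir.1)ᗮ)
    ((finrank_iInf_eq_iff hr hrk hq fun i => (E i).dir).mp hE) fun i => ⟨_, hfoot i⟩
  have hmem : ∀ i, z ∈ (E i).1 := fun i => by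
    have : Flat.ofDir (E i).dir z = E i := by
      refine Flat.ext_dir_foot (by simp) ?_
      rw [Flat.foot_ofDir, ← Submodule.starProjection_orthogonal_val]
      exact hz i
    rw [← this]
    exact AffineSubspace.self_mem_mk' _ _
  exact ⟨Flat.ofDir ⟨_, hE⟩ z, (Flat.iInf_eq_mk' hmem).symm⟩

theorem measurableSet_finrank_iInf_eq {α : Type*} [MeasurableSpace α] (hr : r ≠ 0)
    {L : α → Fin r → Grassmannian n k} (hL : ∀ i, Measurable fun a => L a i) (q : ℕ) :
    MeasurableSet {a | Module.finrank ℝ (⨅ i, (L a i).1 : Submodule ℝ (Space n)) = q} := by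
  have := measurable_finrank_iInf hr hL (measurableSet_singleton (q : ℝ))
  convert this using 1
  ext a
  simp

/-- On the measurable set of tuples with intersection of dimension `q`, intersecting is a measurable
map to `A(n,q)`; the set in question is the preimage of `A`. -/
theorem measurableSet_intersectsIn (hr : r ≠ 0) (hrk : (r - 1) * n ≤ r * k)
    (hq : q = r * k - (r - 1) * n) {A : Set (Flat n q)} (hA : MeasurableSet A) :
    MeasurableSet (intersectsIn A : Set (Fin r → Flat n k)) := by
  set s : Set (Fin r → Flat n k) :=
    {E | Module.finrank ℝ (⨅ i, (E i).dir.1 : Submodule ℝ (Space n)) = q}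
  have hsm : MeasurableSet s := measurableSet_finrank_iInf_eq hr
    (fun i => Flat.measurable_dir.comp (measurable_pi_apply i)) q
  choose F hF using fun E : s => Flat.exists_eq_iInf hr hrk hq E.1 E.2
  have hFm : Measurable F := Flat.measurable_iInf hr
    (fun i => (measurable_pi_apply i).comp measurable_subtype_coe) hF
  have : (intersectsIn A : Set (Fin r → Flat n k)) = Subtype.val '' (F ⁻¹' A) := by
    ext E
    constructor
    · rintro ⟨h0, G, hG, hGE⟩
      have hEs := (subspaceDet_pos_iff hr hrk hq fun i => (E i).dir).mp h0
      refine ⟨⟨E, hEs⟩, ?_, rfl⟩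
      have : F ⟨E, hEs⟩ = G := Subtype.ext ((hF _).trans hGE.symm)
      rwa [Set.mem_preimage, this]
    · rintro ⟨E, hE, rfl⟩
      exact ⟨(subspaceDet_pos_iff hr hrk hq fun i => (E.1 i).dir).mpr E.2, F E, hE, hF E⟩
  rw [this]
  exact hsm.subtype_image (hFm hA)

theorem Flat.ofDir_orthogonalProjectionOnto (L : Grassmannian n k) (y : Space n) :
    Flat.ofDir L ((L.1ᗮ.orthogonalProjectionOnto y : L.1ᗮ) : Space n) = Flat.ofDir L y := by
  refine Flat.ext_dir_foot (by simp) ?_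
  change (Flat.ofDir L (L.1ᗮ.starProjection y)).foot = _
  rw [Flat.foot_ofDir, Flat.foot_ofDir, Submodule.starProjection_orthogonal_val, map_sub,
    Submodule.starProjection_eq_self_iff.mpr (Submodule.starProjection_apply_mem _ _), sub_self,
    sub_zero]

/-- For subspaces `L i` in general position with intersection `M`, the volume of the translation
vectors for which the intersection of the translates of the `L i` belongs to `A`. -/
theorem volume_intersectsIn (hr : r ≠ 0) (hrk : (r - 1) * n ≤ r * k)
    (hq : q = r * k - (r - 1) * n) {A : Set (Flat n q)} (hA : MeasurableSet A)
    (L : Fin r → Grassmannian n k) (M : Grassmannian n q) (hM : M.1 = ⨅ i, (L i).1) :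
    volume {x : (i : Fin r) → (L i).1ᗮ |
        (fun i => Flat.ofDir (L i) (x i : Space n)) ∈ intersectsIn A} =
      ENNReal.ofReal (subspaceDet fun i => (L i).1) *
        volume {z : (M.1)ᗮ | Flat.ofDir M (z : Space n) ∈ A} := by
  have hdim : Module.finrank ℝ (⨅ i, (L i).1 : Submodule ℝ (Space n)) = q := by rw [← hM, M.2]
  have hsup : (M.1)ᗮ = ⨆ i, (L i).1ᗮ := by rw [iSup_orthogonal_eq, hM]
  have hV : MeasurableSet {x : (i : Fin r) → (L i).1ᗮ |
      (fun i => Flat.ofDir (L i) (x i : Space n)) ∈ intersectsIn A} :=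
    measurable_pi_lambda _ (fun i => Flat.measurable_ofDir measurable_const
      (measurable_subtype_coe.comp (measurable_pi_apply i)))
      (measurableSet_intersectsIn hr hrk hq hA)
  rw [volume_pi_eq_spanVolume_mul _ hsup
    (by rw [hsup]; exact (finrank_iInf_eq_iff hr hrk hq L).mp hdim) hV, subspaceDet_eq hrk]
  congr 2
  ext z
  -- Moving each parameter from the projection of `z` back to `z` does not change the flat, so all
  -- the flats pass through `z`.
  have hinf : (Flat.ofDir M (z : Space n)).1 = ⨅ i, (Flat.ofDir (L i) (z : Space n)).1 := by
    change AffineSubspace.mk' (z : Space n) M.1 = ⨅ i, AffineSubspace.mk' (z : Space n) (L i).1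
    rw [iInf_mk']
    exact congrArg (AffineSubspace.mk' (z : Space n)) hM
  simp only [Set.mem_ofPred_eq, Flat.ofDir_orthogonalProjectionOnto, intersectsIn, Flat.dir_ofDir]
  constructor
  · rintro ⟨-, F, hF, hFe⟩
    have : Flat.ofDir M (z : Space n) = F := Subtype.ext (hinf.trans hFe.symm)
    rwa [this]
  · exact fun h => ⟨(subspaceDet_pos_iff hr hrk hq L).mpr hdim, _, h, hinf⟩

/-! ### Lebesgue measure on varying complements, realized in a fixed space. -/

/-- The volume of the unit ball of dimension `d`. -/
def unitBallVolume (d : ℕ) : ℝ≥0∞ := volume (Metric.closedBall (0 : Space d) 1)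

theorem unitBallVolume_ne_zero (d : ℕ) : unitBallVolume d ≠ 0 :=
  (Metric.measure_closedBall_pos _ _ one_pos).ne'

theorem unitBallVolume_ne_top (d : ℕ) : unitBallVolume d ≠ ∞ :=
  measure_closedBall_lt_top.ne

theorem volume_unitBall_submodule (K : Submodule ℝ (Space n)) :
    volume {x : K | ‖(x : Space n)‖ ≤ 1} = unitBallVolume (Module.finrank ℝ K) := by
  have h := ((stdOrthonormalBasis ℝ K).measurePreserving_repr).measure_preimage
    (Metric.isClosed_closedBall (x := 0) (ε := 1)).measurableSet.nullMeasurableSet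
  rw [unitBallVolume, ← h]
  congr 1
  ext x
  simp

/-- The points whose projection to `L` has norm at most one. -/
def tube (L : Submodule ℝ (Space n)) : Set (Space n) := {y | ‖L.starProjection y‖ ≤ 1}

theorem measurableSet_tube (L : Submodule ℝ (Space n)) : MeasurableSet (tube L) :=
  (isClosed_le (L.starProjection.continuous.norm) continuous_const).measurableSet

/-- Lebesgue measure on `Lᗮ` is proportional to the projection of Lebesgue measure on a tube. -/
theorem volume_tube_inter (L : Submodule ℝ (Space n)) {B : Set Lᗮ} (hB : MeasurableSet B) :
    volume (tube L ∩ Lᗮ.orthogonalProjectionOnto ⁻¹' B) =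
      unitBallVolume (Module.finrank ℝ L) * volume B := by
  have hball : MeasurableSet {x : L | ‖(x : Space n)‖ ≤ 1} :=
    measurableSet_le measurable_subtype_coe.norm measurable_const
  have h := ((WithLp.volume_preserving_ofLp L Lᗮ).comp
    L.orthogonalDecomposition.measurePreserving).measure_preimage
    (hball.prod hB).nullMeasurableSet
  rw [Measure.volume_eq_prod, Measure.prod_prod, volume_unitBall_submodule] at h
  rw [← h]
  congr 1
  ext y
  simp [tube, Submodule.orthogonalDecomposition_apply]

/-- By uniqueness of product measures it suffices to compare boxes, where `volume_tube_inter`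
applies in each factor. The left side lives in `(ℝⁿ)^r`, which does not depend on `L`. -/
theorem volume_pi_tube_inter (L : Fin r → Grassmannian n k) {V : Set ((i : Fin r) → (L i).1ᗮ)}
    (hV : MeasurableSet V) :
    volume {y : Fin r → Space n | (∀ i, y i ∈ tube (L i).1) ∧
      (fun i => (L i).1ᗮ.orthogonalProjectionOnto (y i)) ∈ V} =
      unitBallVolume k ^ r * volume V := by
  have hc0 : unitBallVolume k ^ r ≠ 0 := pow_ne_zero _ (unitBallVolume_ne_zero k)
  have hct : unitBallVolume k ^ r ≠ ∞ := ENNReal.pow_ne_top (unitBallVolume_ne_top k)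
  have hm : Measurable fun (y : Fin r → Space n) (i : Fin r) =>
      (L i).1ᗮ.orthogonalProjectionOnto (y i) :=
    measurable_pi_lambda _ fun i =>
      ((L i).1ᗮ.orthogonalProjectionOnto.continuous.measurable).comp (measurable_pi_apply i)
  have hT : MeasurableSet {y : Fin r → Space n | ∀ i, y i ∈ tube (L i).1} :=
    MeasurableSet.univ_pi (fun i => measurableSet_tube (L i).1) |>.congr (by ext; simp)
  have key : Measure.pi (fun i => (volume : Measure (L i).1ᗮ)) = (unitBallVolume k ^ r)⁻¹ •
      ((volume : Measure (Fin r → Space n)).restrict {y | ∀ i, y i ∈ tube (L i).1}).map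
        fun y i => (L i).1ᗮ.orthogonalProjectionOnto (y i) := by
    refine Measure.pi_eq fun s hs => ?_
    rw [Measure.smul_apply, Measure.map_apply hm (MeasurableSet.univ_pi hs),
      Measure.restrict_apply (hm (MeasurableSet.univ_pi hs))]
    have : (fun (y : Fin r → Space n) (i : Fin r) => (L i).1ᗮ.orthogonalProjectionOnto (y i)) ⁻¹'
        Set.univ.pi s ∩ {y | ∀ i, y i ∈ tube (L i).1} =
        Set.univ.pi fun i => tube (L i).1 ∩ (L i).1ᗮ.orthogonalProjectionOnto ⁻¹' s i := by
      ext y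
      simp only [Set.mem_inter_iff, Set.mem_preimage, Set.mem_univ_pi, Set.mem_ofPred_eq,
        ← forall_and]
      exact forall_congr' fun i => and_comm
    rw [this, volume_pi_pi]
    simp only [fun i => volume_tube_inter (L i).1 (hs i), (L _).2, Finset.prod_mul_distrib, Finset.prod_const,
      Finset.card_univ, Fintype.card_fin, smul_eq_mul]
    rw [← mul_assoc, ENNReal.inv_mul_cancel hc0 hct, one_mul]
  have hvol := congrArg (fun μ => μ V) key
  simp only [Measure.smul_apply, Measure.map_apply hm hV, Measure.restrict_apply (hm hV),
    smul_eq_mul] at hvol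
  rw [← volume_pi] at hvol
  rw [hvol, ← mul_assoc, ENNReal.mul_inv_cancel hc0 hct, one_mul]
  congr 1
  ext y
  exact and_comm

/-- The volume of the translation vectors that move the subspaces `L i` to a tuple in `B`. -/
def translationVolume (B : Set (Fin r → Flat n k)) (L : Fin r → Grassmannian n k) : ℝ≥0∞ :=
  volume {x : (i : Fin r) → (L i).1ᗮ | (fun i => Flat.ofDir (L i) (x i : Space n)) ∈ B}

theorem measurable_ofDir_pi : Measurable
    fun (p : (Fin r → Grassmannian n k) × (Fin r → Space n)) (i : Fin r) =>
      Flat.ofDir (p.1 i) (p.2 i) :=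
  measurable_pi_lambda _ fun i => Flat.measurable_ofDir
    ((measurable_pi_apply i).comp measurable_fst) ((measurable_pi_apply i).comp measurable_snd)

/-- The pairs of tuples of subspaces and points with each point in the tube of its subspace. -/
def tubes (n k r : ℕ) : Set ((Fin r → Grassmannian n k) × (Fin r → Space n)) :=
  {p | ∀ i, p.2 i ∈ tube (p.1 i).1}

theorem measurableSet_tubes : MeasurableSet (tubes n k r) := by
  have : tubes n k r = ⋂ i, {p | ‖(p.1 i).1.starProjection (p.2 i)‖ ≤ 1} := by
    ext p
    simp [tubes, tube]
  rw [this]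
  exact MeasurableSet.iInter fun i => measurableSet_le
    (Grassmannian.measurable_starProjection_apply ((measurable_pi_apply i).comp measurable_fst)
      ((measurable_pi_apply i).comp measurable_snd)).norm measurable_const

/-- The right side is the volume of a section of one measurable set in a product space, hence
measurable in `L`. -/
theorem translationVolume_eq {B : Set (Fin r → Flat n k)} (hB : MeasurableSet B)
    (L : Fin r → Grassmannian n k) :
    translationVolume B L = (unitBallVolume k ^ r)⁻¹ *
      volume (Prod.mk L ⁻¹' (tubes n k r ∩
        (fun (p : (Fin r → Grassmannian n k) × (Fin r → Space n)) (i : Fin r) =>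
          Flat.ofDir (p.1 i) (p.2 i)) ⁻¹' B)) := by
  have hV : MeasurableSet {x : (i : Fin r) → (L i).1ᗮ |
      (fun i => Flat.ofDir (L i) (x i : Space n)) ∈ B} :=
    measurable_pi_lambda _ (fun i => Flat.measurable_ofDir measurable_const
      (measurable_subtype_coe.comp (measurable_pi_apply i))) hB
  have h := volume_pi_tube_inter L hV
  simp only [Set.mem_ofPred_eq, Flat.ofDir_orthogonalProjectionOnto] at h
  change _ = (unitBallVolume k ^ r)⁻¹ * volume {y : Fin r → Space n |
    (∀ i, y i ∈ tube (L i).1) ∧ (fun i => Flat.ofDir (L i) (y i)) ∈ B}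
  rw [h, ← mul_assoc, ENNReal.inv_mul_cancel (pow_ne_zero _ (unitBallVolume_ne_zero k))
    (ENNReal.pow_ne_top (unitBallVolume_ne_top k)), one_mul]
  rfl

theorem measurable_translationVolume {B : Set (Fin r → Flat n k)} (hB : MeasurableSet B) :
    Measurable (translationVolume B) := by
  simp only [funext (translationVolume_eq hB)]
  exact (measurable_measure_prodMk_left
    (measurableSet_tubes.inter (measurable_ofDir_pi hB))).const_mul _

theorem translationVolume_pi (B : Fin r → Set (Flat n k)) (L : Fin r → Grassmannian n k) :
    translationVolume (Set.univ.pi B) L =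
      ∏ i, volume {x : (L i).1ᗮ | Flat.ofDir (L i) (x : Space n) ∈ B i} := by
  rw [← volume_pi_pi fun i => {x : (L i).1ᗮ | Flat.ofDir (L i) (x : Space n) ∈ B i},
    translationVolume]
  congr 1

theorem measurable_volume_ofDir {A : Set (Flat n k)} (hA : MeasurableSet A) :
    Measurable fun L : Grassmannian n k =>
      volume {x : (L.1)ᗮ | Flat.ofDir L (x : Space n) ∈ A} := by
  have h := (measurable_translationVolume (r := 1) (MeasurableSet.univ_pi fun _ => hA)).comp
    (measurable_pi_lambda (fun (L : Grassmannian n k) (_ : Fin 1) => L) fun _ => measurable_id)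
  simpa [Function.comp_def, translationVolume_pi] using h

/-- The product measure of a measure with an intensity and a directional distribution. -/
theorem HasIntensityAndDirection.pi_apply {Θ : Measure (Flat n k)} [SigmaFinite Θ] {γ : ℝ≥0}
    {Q : Measure (Grassmannian n k)} (h : HasIntensityAndDirection Θ γ Q)
    {B : Set (Fin r → Flat n k)} (hB : MeasurableSet B) :
    Measure.pi (fun _ : Fin r => Θ) B =
      (γ : ℝ≥0∞) ^ r * ∫⁻ L, translationVolume B L ∂Measure.pi fun _ : Fin r => Q := by
  have hQ := h.1
  -- `Λ` is the right side as a measure in `B`, so that comparison with the product measure is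
  -- needed on boxes only.
  set Λ : Measure (Fin r → Flat n k) := ((γ : ℝ≥0∞) ^ r * (unitBallVolume k ^ r)⁻¹) •
    (((Measure.pi fun _ : Fin r => Q).prod (volume : Measure (Fin r → Space n))).restrict
      (tubes n k r)).map
        fun (p : (Fin r → Grassmannian n k) × (Fin r → Space n)) (i : Fin r) =>
          Flat.ofDir (p.1 i) (p.2 i) with hΛ
  have happly : ∀ {B : Set (Fin r → Flat n k)}, MeasurableSet B → Λ B =
      (γ : ℝ≥0∞) ^ r * ∫⁻ L, translationVolume B L ∂Measure.pi fun _ : Fin r => Q := by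
    intro B hB
    have hm := measurableSet_tubes.inter (measurable_ofDir_pi (n := n) (k := k) hB)
    rw [hΛ, Measure.smul_apply, Measure.map_apply measurable_ofDir_pi hB,
      Measure.restrict_apply (measurable_ofDir_pi hB), Set.inter_comm, Measure.prod_apply hm,
      smul_eq_mul, mul_assoc, ← lintegral_const_mul _ (measurable_measure_prodMk_left hm)]
    simp only [translationVolume_eq hB]
  rw [← happly hB]
  suffices hΘ : Measure.pi (fun _ : Fin r => Θ) = Λ by rw [hΘ]
  refine Measure.pi_eq fun s hs => ?_
  rw [happly (MeasurableSet.univ_pi hs)]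
  simp only [translationVolume_pi]
  -- On a box the integrand is a product of functions of single coordinates, which are independent
  -- under `Q^r`.
  have hind := ProbabilityTheory.iIndepFun_pi (μ := fun _ : Fin r => Q)
    (X := fun (i : Fin r) (L : Grassmannian n k) =>
      volume {x : (L.1)ᗮ | Flat.ofDir L (x : Space n) ∈ s i})
    fun i => (measurable_volume_ofDir (hs i)).aemeasurable
  rw [ProbabilityTheory.lintegral_prod_eq_prod_lintegral_of_indepFun Finset.univ _ hind
    fun i => (measurable_volume_ofDir (hs i)).comp (measurable_pi_apply i)]
  simp only [h.2 _ (hs _), Finset.prod_mul_distrib, Finset.prod_const, Finset.card_univ,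
    Fintype.card_fin]
  congr 1
  refine Finset.prod_congr rfl fun i _ => ?_
  exact (measurePreserving_eval (fun _ : Fin r => Q) i).lintegral_comp
    (measurable_volume_ofDir (hs i))

/-! ### Translation volumes of intersections and the test sets `unitFlats`. -/

theorem translationVolume_intersectsIn (hr : r ≠ 0) (hrk : (r - 1) * n ≤ r * k)
    (hq : q = r * k - (r - 1) * n) {A : Set (Flat n q)} (hA : MeasurableSet A)
    {L : Fin r → Grassmannian n k} {M : Grassmannian n q} (hM : M.1 = ⨅ i, (L i).1) :
    translationVolume (intersectsIn A) L = ENNReal.ofReal (subspaceDet fun i => (L i).1) *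
      volume {z : (M.1)ᗮ | Flat.ofDir M (z : Space n) ∈ A} :=
  volume_intersectsIn hr hrk hq hA L M hM

theorem translationVolume_intersectsIn_of_det_eq_zero {A : Set (Flat n q)}
    {L : Fin r → Grassmannian n k} (hL : subspaceDet (fun i => (L i).1) = 0) :
    translationVolume (intersectsIn A) L = 0 := by
  have h : {x : (i : Fin r) → (L i).1ᗮ |
      (fun i => Flat.ofDir (L i) (x i : Space n)) ∈ intersectsIn A} = ∅ := by
    ext x
    simp [intersectsIn, hL]
  rw [translationVolume, h, measure_empty]

/-- The flats with direction in `A` that meet the unit ball. -/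
def unitFlats (A : Set (Grassmannian n k)) : Set (Flat n k) := {F | F.dir ∈ A ∧ ‖F.foot‖ ≤ 1}

theorem measurableSet_unitFlats {A : Set (Grassmannian n k)} (hA : MeasurableSet A) :
    MeasurableSet (unitFlats A) :=
  (Flat.measurable_dir hA).inter (measurableSet_le Flat.measurable_foot.norm measurable_const)

/-- Apart from the indicator the value is independent of `L`. Hence a measure with intensity `γ` and
direction `Q` gives `unitFlats A` the mass `γ Q(A)` times a constant. -/
theorem volume_unitFlats (A : Set (Grassmannian n k)) (L : Grassmannian n k) :
    volume {x : (L.1)ᗮ | Flat.ofDir L (x : Space n) ∈ unitFlats A} =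
      A.indicator 1 L * unitBallVolume (n - k) := by
  by_cases hL : L ∈ A
  · rw [Set.indicator_of_mem hL, Pi.one_apply, one_mul, ← L.finrank_orthogonal,
      ← volume_unitBall_submodule]
    congr 1
    ext x
    have hx : L.1.starProjection (x : Space n) = 0 :=
      (Submodule.starProjection_apply_eq_zero_iff _).mpr x.2
    simp [unitFlats, hL, Flat.foot_ofDir, hx]
  · have h : {x : (L.1)ᗮ | Flat.ofDir L (x : Space n) ∈ unitFlats A} = ∅ := by
      ext x
      simp [unitFlats, hL]
    rw [Set.indicator_of_notMem hL, zero_mul, h, measure_empty]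

theorem translationVolume_unitFlats (hr : r ≠ 0) (hrk : (r - 1) * n ≤ r * k)
    (hq : q = r * k - (r - 1) * n) {A : Set (Grassmannian n q)} (hA : MeasurableSet A)
    (L : Fin r → Grassmannian n k) :
    translationVolume (intersectsIn (unitFlats A)) L =
      intersectionKernel A L * unitBallVolume (n - q) := by
  by_cases hd : Module.finrank ℝ (⨅ i, (L i).1 : Submodule ℝ (Space n)) = q
  · set M : Grassmannian n q := ⟨_, hd⟩ with hM
    rw [translationVolume_intersectsIn hr hrk hq (measurableSet_unitFlats hA) (M := M) rfl,
      volume_unitFlats, ← mul_assoc, intersectionKernel]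
    congr 1
    by_cases hMA : M ∈ A
    · rw [if_pos ⟨M, hMA, rfl⟩, Set.indicator_of_mem hMA, Pi.one_apply, mul_one]
    · rw [if_neg, Set.indicator_of_notMem hMA, mul_zero]
      rintro ⟨N, hN, hNe⟩
      have : M = N := Subtype.ext hNe.symm
      exact hMA (this ▸ hN)
  · have h0 : subspaceDet (fun i => (L i).1) = 0 :=
      le_antisymm (not_lt.mp ((subspaceDet_pos_iff hr hrk hq L).not.mpr hd))
        (subspaceDet_nonneg hrk L)
    rw [translationVolume_intersectsIn_of_det_eq_zero h0, intersectionKernel, if_neg, zero_mul]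
    rintro ⟨N, -, hN⟩
    exact hd (by rw [← hN, N.2])

/-- The orthonormal bases defining `subspaceDet` are arbitrary choices, so the formula itself does
not show measurability. The determinant is instead recovered as a translation volume divided by a
ball volume. -/
theorem measurable_subspaceDet (hr : r ≠ 0) (hrk : (r - 1) * n ≤ r * k) :
    Measurable fun L : Fin r → Grassmannian n k =>
      ENNReal.ofReal (subspaceDet fun i => (L i).1) := by
  set q := r * k - (r - 1) * n with hq
  have h : (fun L : Fin r → Grassmannian n k => ENNReal.ofReal (subspaceDet fun i => (L i).1)) =
      fun L => translationVolume (intersectsIn (unitFlats (Set.univ : Set (Grassmannian n q)))) L *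
        (unitBallVolume (n - q))⁻¹ := by
    funext L
    rw [translationVolume_unitFlats hr hrk hq MeasurableSet.univ, mul_assoc,
      ENNReal.mul_inv_cancel (unitBallVolume_ne_zero _) (unitBallVolume_ne_top _), mul_one,
      intersectionKernel]
    split_ifs with hM
    · rfl
    · rw [ENNReal.ofReal_eq_zero]
      refine not_lt.mp fun h0 => hM ?_
      exact ⟨⟨_, (subspaceDet_pos_iff hr hrk hq L).mp h0⟩, Set.mem_univ _, rfl⟩
  rw [h]
  exact (measurable_translationVolume (measurableSet_intersectsIn hr hrk hq
    (measurableSet_unitFlats MeasurableSet.univ))).mul_const _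

/-- `M₀` is a default value outside general position; it is harmless because `subspaceDet` vanishes
there and `I` is only used with this density. -/
theorem exists_measurable_iInf (hr : r ≠ 0) (M₀ : Grassmannian n q) :
    ∃ I : (Fin r → Grassmannian n k) → Grassmannian n q, Measurable I ∧
      ∀ L, Module.finrank ℝ (⨅ i, (L i).1 : Submodule ℝ (Space n)) = q →
        (I L).1 = ⨅ i, (L i).1 := by
  classical
  set s : Set (Fin r → Grassmannian n k) :=
    {L | Module.finrank ℝ (⨅ i, (L i).1 : Submodule ℝ (Space n)) = q} with hs
  have hsm : MeasurableSet s := measurableSet_finrank_iInf_eq hr measurable_pi_apply q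
  set f : s → Grassmannian n q := fun L => ⟨⨅ i, (L.1 i).1, L.2⟩ with hf
  have hfm : Measurable f := Grassmannian.measurable_iInf hr (L := fun L : s => L.1)
    (fun i => (measurable_pi_apply i).comp measurable_subtype_coe) fun _ => rfl
  refine ⟨_, Measurable.dite hfm (measurable_const (a := M₀)) hsm, fun L hL => ?_⟩
  have hL' : L ∈ s := hL
  rw [dif_pos hL']

theorem IsLocallyFiniteOnFlats.sigmaFinite {Θ : Measure (Flat n k)}
    (h : IsLocallyFiniteOnFlats Θ) : SigmaFinite Θ :=
  ⟨⟨{ set := fun m => Flat.hitting (Metric.closedBall 0 m)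
      set_mem := fun _ => trivial
      finite := fun m => h _ (isCompact_closedBall 0 (m : ℝ))
      spanning := by
        refine Set.eq_univ_of_forall fun F => ?_
        obtain ⟨m, hm⟩ := exists_nat_ge ‖F.foot‖
        exact Set.mem_iUnion.mpr ⟨m, Flat.mem_hitting_closedBall hm⟩ }⟩⟩

/-! ### The intersection process and its intensity measure. -/

section Processes

variable {Ω : Type*} [MeasurableSpace Ω] {P : Measure Ω} {X : Ω → Set (Flat n k)}

theorem IsOfTypeS.intersectionIntensity_eq (hS : IsOfTypeS P X r) (hr : r ≠ 0)
    (hrk : (r - 1) * n ≤ r * k) (hq : q = r * k - (r - 1) * n) {A : Set (Flat n q)}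
    (hA : MeasurableSet A) :
    intersectionIntensity P X r q A =
      (r ! : ℝ≥0∞)⁻¹ * Measure.pi (fun _ : Fin r => intensityMeasure P X) (intersectsIn A) := by
  -- A finite constant leaves the integral without any measurability of the count.
  have hr0 : (r ! : ℝ≥0∞)⁻¹ ≠ ∞ :=
    ENNReal.inv_ne_top.mpr (Nat.cast_ne_zero.mpr (Nat.factorial_ne_zero r))
  simp only [intersectionIntensity, intersectionProcess]
  rw [lintegral_const_mul' _ _ hr0, ← hS _ (measurableSet_intersectsIn hr hrk hq hA)]
  rfl

/-- If the intersection meets `C`, so does each flat; this bounds the mass by `Θ(hitting C)^r / r!`.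
-/
theorem IsOfTypeS.isLocallyFiniteOnFlats_intersectionIntensity (hX : IsFlatProcess P X)
    (hS : IsOfTypeS P X r) (hr : r ≠ 0) (hrk : (r - 1) * n ≤ r * k)
    (hq : q = r * k - (r - 1) * n) :
    IsLocallyFiniteOnFlats (intersectionIntensity P X r q) := by
  have := hX.intensity_locallyFinite.sigmaFinite
  intro C hC
  rw [hS.intersectionIntensity_eq hr hrk hq (Flat.isClosed_hitting hC).measurableSet]
  refine ENNReal.mul_lt_top (ENNReal.inv_lt_top.mpr ?_) ?_
  · exact Nat.cast_pos.mpr (Nat.factorial_pos r)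
  refine (measure_mono (t := Set.univ.pi fun _ => Flat.hitting C) ?_).trans_lt ?_
  · rintro E ⟨-, F, ⟨x, hx, hxC⟩, hF⟩ i -
    rw [hF] at hx
    exact ⟨x, (iInf_le (fun i => (E i).1) i) hx, hxC⟩
  · rw [Measure.pi_pi]
    exact ENNReal.prod_lt_top fun i _ => hX.intensity_locallyFinite C hC

theorem IsOfTypeS.intersectionIntensity_eq_lintegral (hX : IsFlatProcess P X)
    (hS : IsOfTypeS P X r) (hr : r ≠ 0) (hrk : (r - 1) * n ≤ r * k)
    (hq : q = r * k - (r - 1) * n) {γ : ℝ≥0} {Q : Measure (Grassmannian n k)}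
    (hγQ : HasIntensityAndDirection (intensityMeasure P X) γ Q) {A : Set (Flat n q)}
    (hA : MeasurableSet A) :
    intersectionIntensity P X r q A = (γ : ℝ≥0∞) ^ r / (r ! : ℝ≥0∞) *
      ∫⁻ L, translationVolume (intersectsIn A) L ∂Measure.pi fun _ : Fin r => Q := by
  have := hX.intensity_locallyFinite.sigmaFinite
  rw [hS.intersectionIntensity_eq hr hrk hq hA,
    hγQ.pi_apply (measurableSet_intersectsIn hr hrk hq hA), ← mul_assoc, div_eq_mul_inv,
    mul_comm (r ! : ℝ≥0∞)⁻¹]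

/-- Normalizing `μ` gives the direction and its total mass the intensity. The mass is finite because
`Θ (unitFlats Set.univ)` is `μ Set.univ` times a nonzero ball volume; if it is zero, any direction
will do. -/
theorem hasIntensityAndDirection_of_lintegral {Θ : Set (Flat n q) → ℝ≥0∞}
    (hΘ : Θ (unitFlats Set.univ) ≠ ∞) (M₀ : Grassmannian n q) {μ : Measure (Grassmannian n q)}
    (hμ : ∀ A, MeasurableSet A →
      Θ A = ∫⁻ L, volume {x : (L.1)ᗮ | Flat.ofDir L (x : Space n) ∈ A} ∂μ) :
    ∃ (γ : ℝ≥0) (Q : Measure (Grassmannian n q)), HasIntensityAndDirection Θ γ Q := by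
  have htop : μ Set.univ ≠ ∞ := by
    intro h
    rw [hμ _ (measurableSet_unitFlats MeasurableSet.univ)] at hΘ
    simp [volume_unitFlats, h, unitBallVolume_ne_zero] at hΘ
  by_cases h0 : μ Set.univ = 0
  · refine ⟨0, Measure.dirac M₀, inferInstance, fun A hA => ?_⟩
    rw [hμ A hA, Measure.measure_univ_eq_zero.mp h0]
    simp
  · refine ⟨(μ Set.univ).toNNReal, (μ Set.univ)⁻¹ • μ, ⟨?_⟩, fun A hA => ?_⟩
    · rw [Measure.smul_apply, smul_eq_mul, ENNReal.inv_mul_cancel h0 htop]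
    · rw [hμ A hA, lintegral_smul_measure, smul_eq_mul, ENNReal.coe_toNNReal htop, ← mul_assoc,
        ENNReal.mul_inv_cancel h0 htop, one_mul]

theorem IsOfTypeS.exists_hasIntensityAndDirection (hX : IsFlatProcess P X)
    (hS : IsOfTypeS P X r) (hr : r ≠ 0) (hrk : (r - 1) * n ≤ r * k)
    (hq : q = r * k - (r - 1) * n) (hqn : q ≤ n) {γ : ℝ≥0} {Q : Measure (Grassmannian n k)}
    (hγQ : HasIntensityAndDirection (intensityMeasure P X) γ Q) :
    ∃ (γr : ℝ≥0) (Qr : Measure (Grassmannian n q)),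
      HasIntensityAndDirection (intersectionIntensity P X r q) γr Qr := by
  obtain ⟨M₀⟩ := Grassmannian.nonempty hqn
  obtain ⟨I, hI, hIeq⟩ := exists_measurable_iInf (k := k) hr M₀
  have hfin : intersectionIntensity P X r q (unitFlats Set.univ) ≠ ∞ := by
    refine ne_top_of_le_ne_top (hS.isLocallyFiniteOnFlats_intersectionIntensity hX hr hrk hq _
      (isCompact_closedBall 0 1)).ne (lintegral_mono fun ω => ?_)
    have hsub : (intersectsIn (unitFlats (Set.univ : Set (Grassmannian n q))) :
        Set (Fin r → Flat n k)) ⊆ intersectsIn (Flat.hitting (Metric.closedBall 0 1) : Set (Flat n q)) := by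
      rintro E ⟨h, F, hF, hE⟩
      exact ⟨h, F, Flat.mem_hitting_closedBall hF.2, hE⟩
    refine mul_le_mul_right ?_ _
    exact ENat.toENNReal_le.mpr (Set.encard_le_encard (Set.inter_subset_inter_right _ hsub))
  have hdet := measurable_subspaceDet (n := n) hr hrk
  -- The unnormalized direction measure: the image under intersection of `Q^r` weighted with the
  -- determinant.
  refine hasIntensityAndDirection_of_lintegral hfin M₀
    (μ := ((γ : ℝ≥0∞) ^ r / (r ! : ℝ≥0∞)) • ((Measure.pi fun _ : Fin r => Q).withDensity
      fun L => ENNReal.ofReal (subspaceDet fun i => (L i).1)).map I) fun A hA => ?_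
  rw [hS.intersectionIntensity_eq_lintegral hX hr hrk hq hγQ hA, lintegral_smul_measure,
    lintegral_map (measurable_volume_ofDir hA) hI, smul_eq_mul]
  congr 1
  refine Eq.trans (lintegral_congr fun L => ?_) (lintegral_withDensity_eq_lintegral_mul _ hdet
    ((measurable_volume_ofDir hA).comp hI)).symm
  rw [Pi.mul_apply]
  by_cases h0 : 0 < subspaceDet fun i => (L i).1
  · exact translationVolume_intersectsIn hr hrk hq hA
      (hIeq L ((subspaceDet_pos_iff hr hrk hq L).mp h0))
  · have h0' : subspaceDet (fun i => (L i).1) = 0 :=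
      le_antisymm (not_lt.mp h0) (subspaceDet_nonneg hrk L)
    rw [translationVolume_intersectsIn_of_det_eq_zero h0', h0', ENNReal.ofReal_zero, zero_mul]

/-- Both representations of the intersection intensity are evaluated at `unitFlats A`, and the
common factor `unitBallVolume (n - q)` cancels. -/
theorem IsOfTypeS.intensity_mul_direction_eq (hX : IsFlatProcess P X)
    (hS : IsOfTypeS P X r) (hr : r ≠ 0) (hrk : (r - 1) * n ≤ r * k)
    (hq : q = r * k - (r - 1) * n) {γ : ℝ≥0} {Q : Measure (Grassmannian n k)}
    (hγQ : HasIntensityAndDirection (intensityMeasure P X) γ Q) {γr : ℝ≥0}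
    {Qr : Measure (Grassmannian n q)}
    (hγQr : HasIntensityAndDirection (intersectionIntensity P X r q) γr Qr)
    {A : Set (Grassmannian n q)} (hA : MeasurableSet A) :
    (γr : ℝ≥0∞) * Qr A = (γ : ℝ≥0∞) ^ r / (r ! : ℝ≥0∞) *
      ∫⁻ L, intersectionKernel A L ∂Measure.pi fun _ : Fin r => Q := by
  have hc0 := unitBallVolume_ne_zero (n - q)
  have hct := unitBallVolume_ne_top (n - q)
  have h := hγQr.2 _ (measurableSet_unitFlats hA)
  rw [hS.intersectionIntensity_eq_lintegral hX hr hrk hq hγQ (measurableSet_unitFlats hA)] at h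
  simp only [translationVolume_unitFlats hr hrk hq hA, volume_unitFlats] at h
  rw [lintegral_mul_const' _ _ hct, lintegral_mul_const' _ _ hct, lintegral_indicator_one hA,
    ← mul_assoc, ← mul_assoc] at h
  exact ((ENNReal.mul_left_inj hc0 hct).mp h).symm

end Processes

end FlatProcesses

end

theorem mainTheorem8 {Ω : Type*} [MeasurableSpace Ω] (P : MeasureTheory.Measure Ω)
    [MeasureTheory.IsProbabilityMeasure P]
    (n k r q : ℕ) (hn : 2 ≤ n) (hr : 2 ≤ r) (hk : n ≤ 2 * k) (hkn : k ≤ n - 1)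
    (hrk : (r - 1) * n ≤ r * k) (hq : q = r * k - (r - 1) * n)
    (X : Ω → Set (FlatProcesses.Flat n k)) (hX : FlatProcesses.IsFlatProcess P X)
    (hstat : FlatProcesses.IsWeaklyStationary P X) (hS : FlatProcesses.IsOfTypeS P X r)
    (γ : NNReal) (Q : MeasureTheory.Measure (FlatProcesses.Grassmannian n k))
    (hγQ : FlatProcesses.HasIntensityAndDirection (FlatProcesses.intensityMeasure P X) γ Q) :
    FlatProcesses.IsTranslationInvariant (FlatProcesses.intersectionIntensity P X r q) ∧
    FlatProcesses.IsLocallyFiniteOnFlats (FlatProcesses.intersectionIntensity P X r q) ∧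
    (∃ (γr : NNReal) (Qr : MeasureTheory.Measure (FlatProcesses.Grassmannian n q)),
      FlatProcesses.HasIntensityAndDirection
        (FlatProcesses.intersectionIntensity P X r q) γr Qr) ∧
    ∀ (γr : NNReal) (Qr : MeasureTheory.Measure (FlatProcesses.Grassmannian n q)),
      FlatProcesses.HasIntensityAndDirection
        (FlatProcesses.intersectionIntensity P X r q) γr Qr →
      ∀ A : Set (FlatProcesses.Grassmannian n q), MeasurableSet A →
        (γr : ENNReal) * Qr A = (γ : ENNReal) ^ r / (Nat.factorial r : ENNReal) *
          ∫⁻ L : Fin r → FlatProcesses.Grassmannian n k, FlatProcesses.intersectionKernel A L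
            ∂(MeasureTheory.Measure.pi fun _ : Fin r => Q) := by
  have hr0 : r ≠ 0 := by omega
  have hqn : q ≤ n := by
    have h1 : r * k ≤ r * n := Nat.mul_le_mul_left r (by omega)
    have h2 : (r - 1) * n + n = r * n := by
      rw [← Nat.succ_mul, Nat.succ_eq_add_one, Nat.sub_add_cancel (by omega)]
    omega
  have hex := hS.exists_hasIntensityAndDirection hX hr0 hrk hq hqn hγQ
  refine ⟨?_, hS.isLocallyFiniteOnFlats_intersectionIntensity hX hr0 hrk hq, hex,
    fun γr Qr h A hA => hS.intensity_mul_direction_eq hX hr0 hrk hq hγQ h hA⟩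
  -- Translation invariance is read off the representation just obtained.
  obtain ⟨γr, Qr, h⟩ := hex
  exact h.isTranslationInvariant
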